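/- For a word $w$ over a finite alphabet $\Sigma$, let $R(w)$ be the largest radius of a palindrome in $w$, i.e. the largest $r\ge 0$ such that $w$ contains a fragment $x x^R$ with $|x|=r$, where $x^R$ is the reversal of $x$ (palindromes of even length are considered). A streaming algorithm with $s$ bits of memory reads the letters of its input one by one. In every step it sees only the current letter and its $s$ bits of memory, and it computes from them (and possibly from the number of the step) the new contents of the memory and outputs a number. The input length $n$ and the parameter $\varepsilon$ are known to it in advance. A Monte Carlo streaming algorithm is a random such algorithm, with the same $s$ for all random choices. It approximates $R$ within the factor $(1+\varepsilon)$ with probability $p$ on words of length $n$ if, for every $w\in\Sigma^n$, the number $\ell$ that it outputs after reading $w$ satisfies $\ell\le R(w)\le(1+\varepsilon)\ell$ with probability at least $p$. Theorem (Monte Carlo multiplicative approximation). There are absolute constants $c>0$ and $N$ such that the following holds for all $n\ge N$, all real $\varepsilon$ with $n^{-0.98}\le\varepsilon\le n^{0.49}$ and all nonempty finite alphabets $\Sigma$. Every Monte Carlo streaming algorithm that approximates $R$ within the factor $(1+\varepsilon)$ with probability $1-\frac1n$ on words of length $n$ over $\Sigma$ uses at least $$c\cdot\frac{\log n}{\log(1+\varepsilon)}\cdot\log\min\left\{|\Sigma|,\frac{\log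 n}{\log(1+\varepsilon)}\right\}$$ bits of memory. -/

import Mathlib

/-- The word `w` contains an even palindrome of radius `r`, that is, a fragment of the form
`x xᴿ` with `|x| = r`. -/
def HasPalindromeOfRadius {A : Type*} (w : List A) (r : ℕ) : Prop :=
  ∃ x : List A, x.length = r ∧ (x ++ x.reverse) <:+: w

/-- The largest radius of a palindrome in `w` (half of the length of its longest even palindrome;
it is `0` if there is no nonempty one). -/
noncomputable def maxPalRadius {A : Type*} (w : List A) : ℕ :=
  sSup {r | HasPalindromeOfRadius w r}

/-- The supremum that defines `maxPalRadius` is attained. -/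
theorem isGreatest_maxPalRadius {A : Type*} (w : List A) :
    IsGreatest {r | HasPalindromeOfRadius w r} (maxPalRadius w) := by
  have hb : BddAbove {r | HasPalindromeOfRadius w r} := by
    refine ⟨w.length, ?_⟩
    rintro r ⟨x, hx, hw⟩
    have := hw.length_le
    simp at this
    omega
  have hne : {r | HasPalindromeOfRadius w r}.Nonempty := ⟨0, [], rfl, by simp⟩
  exact ⟨Nat.sSup_mem hne hb, fun r hr => le_csSup hb hr⟩

/-- A deterministic streaming algorithm over the alphabet `A` with `s` bits of memory. In each step
it receives one letter; from the number of the step, the current contents of its memory and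
the letter, it computes the new contents of the memory and outputs a number.
The code of the algorithm is arbitrary and may use the number of the step, the length of the input
and the error parameter for free; only the stored data is counted. -/
structure DetStreamAlg (A : Type*) (s : ℕ) where
  /-- initial contents of the memory -/
  init : Fin s → Bool
  /-- new contents of the memory, and the number output in this step -/
  step : ℕ → (Fin s → Bool) → A → (Fin s → Bool) × ℝ

namespace DetStreamAlg

variable {A : Type*} {s : ℕ}

/-- Process the letters of a word one by one, from step `h` on, where the pair holds the current
memory and the most recent output. -/
def runFrom (D : DetStreamAlg A s) : ℕ → (Fin s → Bool) × ℝ → List A → (Fin s → Bool) × ℝ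
  | _, p, [] => p
  | h, p, a :: w => D.runFrom (h + 1) (D.step h p.1 a) w

/-- The number output after the last letter of `w` has been read
(with the default `0` on the empty word, where there is no step). -/
def answer (D : DetStreamAlg A s) (w : List A) : ℝ :=
  (D.runFrom 1 (D.init, 0) w).2

end DetStreamAlg

/-- A randomized streaming algorithm whose memory is `s` bits for every random choice: a random
deterministic one, drawn by means of a probability space `Ω` of random choices, such that
its answer on every fixed word is a random variable. Since a deterministic algorithm may use the
number of the step, coins that are tossed afresh in every step are included. -/
structure MonteCarloStreamAlg (A : Type*) (s : ℕ) (Ω : Type*) [MeasurableSpace Ω] where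
  /-- distribution of the random choices -/
  prob : MeasureTheory.Measure Ω
  isProb : MeasureTheory.IsProbabilityMeasure prob
  /-- the deterministic algorithm selected by the random choices -/
  alg : Ω → DetStreamAlg A s
  measurable_answer : ∀ w : List A, Measurable fun ω => (alg ω).answer w

/-- On every input word of length `n`, with probability at least `p`, the final answer `ℓ` satisfies
`ℓ ≤ R ≤ (1 + ε) ℓ`, where `R` is the largest radius of a palindrome in the word. -/
def MonteCarloStreamAlg.SolvesMultiplicative {A : Type*} {s : ℕ} {Ω : Type*} [MeasurableSpace Ω]
    (M : MonteCarloStreamAlg A s Ω) (n : ℕ) (ε p : ℝ) : Prop :=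
  ∀ w : List A, w.length = n →
    p ≤ M.prob.real {ω | (M.alg ω).answer w ≤ (maxPalRadius w : ℝ) ∧
      (maxPalRadius w : ℝ) ≤ (1 + ε) * (M.alg ω).answer w}

/-!
The proof is a one-way communication argument. A message `x` of `m` letters from an alphabet of `q`
letters is written into the left half of the input, and a query `z` of the same shape into the right
half (`biWord`). Seen from the centre, each half is the alternating sequence `a b a b ⋯` in which
the letters at the sparse positions `p 0 < ⋯ < p (m - 1)` are replaced by the message (`markedAlt`).

An alternating sequence contains no even palindrome at all, and isolated changes create only
palindromes of radius one (`noLongPal_markedAlt`). Hence the longest palindrome of the input sits in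
its centre, and its radius tells where `x` and `z` begin to differ: it is at most `p i` if they
differ at the mark `i`, and at least `p (i + 1)` if they agree up to and including `i`. With
`p (k + 1) > (1 + ε) p k`, no single answer is valid in both cases. A memory state that leads to
correct answers to the `m q` queries "`x` up to the mark `i`, and then the letter `c`" therefore
determines `x` (`DetStreamAlg.eq_of_memory_eq`).

If `2 m q < n`, then by the union bound every message has all its queries answered correctly with
probability more than `1 / 2`, and averaging over the random choices gives `q ^ m < 2 ^ (s + 1)`
(`MonteCarloStreamAlg.card_pow_lt`). The positions `p (k + 1) = ⌊(1 + ε) p k⌋ + 4` satisfy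
`p k ≤ (1 + ε) ^ k (2 + 4 / ε)`, so in the given range of `ε` there is room in half a word for
`m = ⌈0.01 log n / log (1 + ε)⌉` marks (`markPos_le_half`). As `m` is `O(n ^ 0.99)`, the condition on
`m q` leaves room for `q = min {|A|, ⌈n ^ 0.001⌉}`, whose logarithm is of the right order
(`log_min_le`).
-/

/-! ### The memory of a deterministic algorithm -/

theorem DetStreamAlg.runFrom_append {A : Type*} {s : ℕ} (D : DetStreamAlg A s) (u v : List A)
    (h : ℕ) (p : (Fin s → Bool) × ℝ) :
    D.runFrom h p (u ++ v) = D.runFrom (h + u.length) (D.runFrom h p u) v := by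
  induction u generalizing h p with
  | nil => simp [DetStreamAlg.runFrom]
  | cons a u ih =>
    simp only [List.cons_append, DetStreamAlg.runFrom, ih, List.length_cons]
    congr 1
    omega

/-- The contents of the memory after a word has been read. -/
def DetStreamAlg.memory {A : Type*} {s : ℕ} (D : DetStreamAlg A s) (u : List A) : Fin s → Bool :=
  (D.runFrom 1 (D.init, 0) u).1

theorem DetStreamAlg.answer_append_eq {A : Type*} {s : ℕ} (D : DetStreamAlg A s) {u u' v : List A}
    (hlen : u.length = u'.length) (hmem : D.memory u = D.memory u') (hv : v ≠ []) :
    D.answer (u ++ v) = D.answer (u' ++ v) := by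
  obtain ⟨a, v, rfl⟩ := List.exists_cons_of_ne_nil hv
  simp only [DetStreamAlg.memory] at hmem
  simp only [DetStreamAlg.answer, DetStreamAlg.runFrom_append, DetStreamAlg.runFrom, hlen, hmem]

/-! ### Palindromes in two-sided words -/

theorem le_maxPalRadius {A : Type*} {w : List A} {r : ℕ} (h : HasPalindromeOfRadius w r) :
    r ≤ maxPalRadius w :=
  (isGreatest_maxPalRadius w).2 h

theorem maxPalRadius_le {A : Type*} {w : List A} {R : ℕ}
    (h : ∀ r, HasPalindromeOfRadius w r → r ≤ R) : maxPalRadius w ≤ R :=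
  h _ (isGreatest_maxPalRadius w).1

/-- A palindrome of radius `r` is centred between the positions `q - 1` and `q`. -/
theorem HasPalindromeOfRadius.exists_center {A : Type*} {w : List A} {r : ℕ}
    (h : HasPalindromeOfRadius w r) :
    ∃ q, r ≤ q ∧ q + r ≤ w.length ∧ ∀ j < r, w[q - 1 - j]? = w[q + j]? := by
  obtain ⟨x, hx, s, t, rfl⟩ := h
  refine ⟨s.length + r, by omega, by simp; omega, fun j hj => ?_⟩
  have h1 : (s ++ (x ++ x.reverse) ++ t)[s.length + r - 1 - j]? = x[r - 1 - j]? := by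
    rw [List.getElem?_append_left (by simp; omega), List.getElem?_append_right (by omega),
      List.getElem?_append_left (by omega)]
    congr 1
    omega
  have h2 : (s ++ (x ++ x.reverse) ++ t)[s.length + r + j]? = x[r - 1 - j]? := by
    rw [List.getElem?_append_left (by simp; omega), List.getElem?_append_right (by omega),
      List.getElem?_append_right (by omega), List.getElem?_reverse (by omega)]
    congr 1
    omega
  rw [h1, h2]

/-- The word whose left half is `f` and whose right half is `g`, both indexed by the distance from
the centre: `f (h - 1) ⋯ f 1 f 0 g 0 g 1 ⋯ g (k - 1)`. -/
def biWord {A : Type*} (f g : ℕ → A) (h k : ℕ) : List A :=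
  ((List.range h).map f).reverse ++ (List.range k).map g

theorem length_biWord {A : Type*} (f g : ℕ → A) (h k : ℕ) : (biWord f g h k).length = h + k := by
  simp [biWord]

theorem getElem?_biWord_left {A : Type*} (f g : ℕ → A) {h k i : ℕ} (hi : i < h) :
    (biWord f g h k)[h - 1 - i]? = some (f i) := by
  have h1 : h - 1 - (h - 1 - i) = i := by omega
  rw [biWord, List.getElem?_append_left (by simp; omega), List.getElem?_reverse (by simp; omega)]
  simp [h1, hi]

theorem getElem?_biWord_right {A : Type*} (f g : ℕ → A) {h k i : ℕ} (hi : i < k) :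
    (biWord f g h k)[h + i]? = some (g i) := by
  rw [biWord, List.getElem?_append_right (by simp)]
  simp [hi]

theorem hasPalindromeOfRadius_biWord {A : Type*} {f g : ℕ → A} {h k r : ℕ} (hr : r ≤ h)
    (hk : r ≤ k) (hfg : ∀ j < r, f j = g j) : HasPalindromeOfRadius (biWord f g h k) r := by
  obtain ⟨d, rfl⟩ := Nat.exists_eq_add_of_le hr
  obtain ⟨e, rfl⟩ := Nat.exists_eq_add_of_le hk
  have hmap : (List.range r).map f = (List.range r).map g :=
    List.map_congr_left fun j hj => hfg j (List.mem_range.1 hj)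
  refine ⟨((List.range r).map g).reverse, by simp,
    (((List.range d).map (r + ·)).map f).reverse, ((List.range e).map (r + ·)).map g, ?_⟩
  simp only [biWord, List.range_add, List.map_append, List.reverse_append, List.reverse_reverse,
    hmap, List.append_assoc]

/-- A sequence has no long even palindrome: two equal neighbours are never enclosed by two further
equal letters, and it does not begin with two equal letters. -/
def NoLongPal {A : Type*} (f : ℕ → A) : Prop :=
  f 0 ≠ f 1 ∧ ∀ t, f (t + 1) = f (t + 2) → f t ≠ f (t + 3)

/-- Long palindromes of a two-sided word without long one-sided palindromes sit in the centre. -/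
theorem HasPalindromeOfRadius.eq_of_noLongPal {A : Type*} {f g : ℕ → A} {h k r : ℕ}
    (hf : NoLongPal f) (hg : NoLongPal g) (hr : 2 ≤ r)
    (hw : HasPalindromeOfRadius (biWord f g h k) r) : ∀ j < r, f j = g j := by
  obtain ⟨q, hq, hqr, hj⟩ := hw.exists_center
  rw [length_biWord] at hqr
  have h0 := hj 0 (by omega)
  have h1 := hj 1 (by omega)
  rcases lt_trichotomy q h with hlt | rfl | hgt
  · obtain ⟨t, rfl⟩ : ∃ t, h = q + 1 + t := Nat.exists_eq_add_of_lt hlt |>.imp fun t ht => by omega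
    have e0 := getElem?_biWord_left f g (h := q + 1 + t) (k := k) (i := t + 1) (by omega)
    have e1 := getElem?_biWord_left f g (h := q + 1 + t) (k := k) (i := t) (by omega)
    have e2 := getElem?_biWord_left f g (h := q + 1 + t) (k := k) (i := t + 2) (by omega)
    rw [show q + 1 + t - 1 - (t + 1) = q - 1 - 0 by omega, h0] at e0
    rw [show q + 1 + t - 1 - t = q + 0 by omega, e0] at e1
    rw [show q + 1 + t - 1 - (t + 2) = q - 1 - 1 by omega, h1] at e2
    rcases t with _ | t
    · exact absurd (Option.some.inj e1).symm hf.1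
    · have e3 := getElem?_biWord_left f g (h := q + 1 + (t + 1)) (k := k) (i := t) (by omega)
      rw [show q + 1 + (t + 1) - 1 - t = q + 1 by omega, e2] at e3
      exact absurd (Option.some.inj e3).symm (hf.2 t (Option.some.inj e1).symm)
  · intro j hjr
    have e0 := hj j hjr
    rw [getElem?_biWord_left f g (by omega), getElem?_biWord_right f g (by omega)] at e0
    exact Option.some.inj e0
  · obtain ⟨t, rfl⟩ : ∃ t, q = h + 1 + t := Nat.exists_eq_add_of_lt hgt |>.imp fun t ht => by omega
    have e0 := getElem?_biWord_right f g (h := h) (k := k) (i := t + 1) (by omega)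
    have e1 := getElem?_biWord_right f g (h := h) (k := k) (i := t) (by omega)
    have e2 := getElem?_biWord_right f g (h := h) (k := k) (i := t + 2) (by omega)
    rw [show h + (t + 1) = h + 1 + t + 0 by omega, ← h0] at e0
    rw [show h + t = h + 1 + t - 1 - 0 by omega, e0] at e1
    rw [show h + (t + 2) = h + 1 + t + 1 by omega, ← h1] at e2
    rcases t with _ | t
    · exact absurd (Option.some.inj e1).symm hg.1
    · have e3 := getElem?_biWord_right f g (h := h) (k := k) (i := t) (by omega)
      rw [show h + t = h + 1 + (t + 1) - 1 - 1 by omega, e2] at e3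
      exact absurd (Option.some.inj e3).symm (hg.2 t (Option.some.inj e1).symm)

/-! ### Alternating sequences with sparse marks -/

open Classical in
/-- The alternating sequence `a b a b ⋯` in which the letter at position `p k` is replaced by `y k`,
for every `k < m`. -/
noncomputable def markedAlt {A : Type*} (a b : A) (p : ℕ → ℕ) {m : ℕ} (y : Fin m → A) (j : ℕ) : A :=
  if h : ∃ k : Fin m, p k = j then y h.choose else if Even j then a else b

section markedAlt

variable {A : Type*} {a b : A} {p : ℕ → ℕ} {m : ℕ}

theorem markedAlt_mark (hp : StrictMono p) (y : Fin m → A) (k : Fin m) :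
    markedAlt a b p y (p k) = y k := by
  have h : ∃ k' : Fin m, p k' = p k := ⟨k, rfl⟩
  rw [markedAlt, dif_pos h]
  exact congrArg y (Fin.ext (hp.injective h.choose_spec))

theorem markedAlt_of_ne (y : Fin m → A) {j : ℕ} (hj : ∀ k : Fin m, p k ≠ j) :
    markedAlt a b p y j = if Even j then a else b := by
  rw [markedAlt, dif_neg (by simpa using hj)]

/-- If the marked positions are sparse, then the palindromes between two equal neighbours, one of
which is marked, are destroyed by the unmarked letters around them, whose positions
have different parities. -/
theorem noLongPal_markedAlt (hab : a ≠ b) (h0 : 2 ≤ p 0) (hp : ∀ k, p k + 4 ≤ p (k + 1))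
    (y : Fin m → A) : NoLongPal (markedAlt a b p y) := by
  have hmono : StrictMono p := strictMono_nat_of_lt_succ fun k => by have := hp k; omega
  have hge : ∀ k, 2 ≤ p k := fun k => h0.trans (hmono.monotone (Nat.zero_le k))
  have hsep : ∀ k l, p k < p l → p k + 4 ≤ p l := fun k l hkl =>
    (hp k).trans (hmono.monotone (hmono.lt_iff_lt.1 hkl))
  constructor
  · rw [markedAlt_of_ne y fun k => by have := hge k; omega,
      markedAlt_of_ne y fun k => by have := hge k; omega]
    simpa using hab
  · intro t ht
    by_cases hm : ∃ k : Fin m, p k = t + 1 ∨ p k = t + 2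
    · obtain ⟨k, hk⟩ := hm
      have hn : ∀ l : Fin m, p l ≠ t ∧ p l ≠ t + 3 := fun l => by
        have h1 := hsep k l
        have h2 := hsep l k
        omega
      rw [markedAlt_of_ne y fun l => (hn l).1, markedAlt_of_ne y fun l => (hn l).2]
      by_cases he : Even t
      · simpa [he, Nat.even_add, show ¬ Even 3 by decide] using hab
      · simpa [he, Nat.even_add, show ¬ Even 3 by decide] using hab.symm
    · push Not at hm
      rw [markedAlt_of_ne y fun l => (hm l).1, markedAlt_of_ne y fun l => (hm l).2] at ht
      exfalso
      by_cases he : Even t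
      · simp [he, Nat.even_add] at ht
        exact hab ht.symm
      · simp [he, Nat.even_add] at ht
        exact hab ht

theorem markedAlt_eq_of_lt (hp : StrictMono p) {y z : Fin m → A} {i : ℕ}
    (h : ∀ k : Fin m, (k : ℕ) < i → y k = z k) {j : ℕ} (hj : j < p i) :
    markedAlt a b p y j = markedAlt a b p z j := by
  by_cases hm : ∃ k : Fin m, p k = j
  · obtain ⟨k, rfl⟩ := hm
    rw [markedAlt_mark hp, markedAlt_mark hp, h k (hp.lt_iff_lt.1 hj)]
  · push Not at hm
    rw [markedAlt_of_ne y hm, markedAlt_of_ne z hm]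

/-- The radius jumps at the first mark in which the halves differ: here it does not exceed the
position of that mark. -/
theorem maxPalRadius_le_of_mark_ne (hab : a ≠ b) (h0 : 2 ≤ p 0) (hp : ∀ k, p k + 4 ≤ p (k + 1))
    {y z : Fin m → A} {i : Fin m} (hi : y i ≠ z i) (h k : ℕ) :
    maxPalRadius (biWord (markedAlt a b p y) (markedAlt a b p z) h k) ≤ p i := by
  have hmono : StrictMono p := strictMono_nat_of_lt_succ fun k => by have := hp k; omega
  refine maxPalRadius_le fun r hr => ?_
  by_contra! hlt
  have h2 : 2 ≤ p i := h0.trans (hmono.monotone (Nat.zero_le _))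
  have := hr.eq_of_noLongPal (noLongPal_markedAlt hab h0 hp y) (noLongPal_markedAlt hab h0 hp z)
    (by omega) (p i) hlt
  rw [markedAlt_mark hmono, markedAlt_mark hmono] at this
  exact hi this

theorem le_maxPalRadius_of_marks_eq (hp : StrictMono p) {y z : Fin m → A} {i h k : ℕ}
    (hyz : ∀ l : Fin m, (l : ℕ) < i → y l = z l) (hh : p i ≤ h) (hk : p i ≤ k) :
    p i ≤ maxPalRadius (biWord (markedAlt a b p y) (markedAlt a b p z) h k) :=
  le_maxPalRadius (hasPalindromeOfRadius_biWord hh hk fun _ hj => markedAlt_eq_of_lt hp hyz hj)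

end markedAlt

/-! ### Decoding a message from the memory -/

/-- The query `z` for the mark `i` and the letter `c`: it agrees with `x` before `i` and is constantly
`c` from `i` on. -/
def queryAt {B : Type*} {m : ℕ} (x : Fin m → B) (i : Fin m) (c : B) (k : Fin m) : B :=
  if k < i then x k else c

/-- An algorithm answers correctly on the word `w`. -/
def DetStreamAlg.Correct {A : Type*} {s : ℕ} (D : DetStreamAlg A s) (ε : ℝ) (w : List A) : Prop :=
  D.answer w ≤ (maxPalRadius w : ℝ) ∧ (maxPalRadius w : ℝ) ≤ (1 + ε) * D.answer w

/-- A deterministic algorithm has different memory contents after the left halves of any two messages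
for which it answers all queries correctly: at the first mark `i` where `x` and `x'` differ, the query
`queryAt x i (x i)` is a query to both of them, after which the radii differ by more than the
factor `1 + ε` although the answers are the same. -/
theorem DetStreamAlg.eq_of_memory_eq {A : Type*} {s : ℕ} (D : DetStreamAlg A s) {a b : A}
    (hab : a ≠ b) {p : ℕ → ℕ} (h0 : 2 ≤ p 0) (hp : ∀ k, p k + 4 ≤ p (k + 1)) {ε : ℝ} (hε : 0 ≤ ε)
    (hgrow : ∀ k, (1 + ε) * p k < p (k + 1)) {m h k : ℕ} (hh : p m ≤ h) (hk : p m ≤ k)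
    {B : Type*} {e : B → A} (he : Function.Injective e) {x x' : Fin m → B}
    (hx : ∀ i c, D.Correct ε (biWord (markedAlt a b p (e ∘ x))
      (markedAlt a b p (e ∘ queryAt x i c)) h k))
    (hx' : ∀ i c, D.Correct ε (biWord (markedAlt a b p (e ∘ x'))
      (markedAlt a b p (e ∘ queryAt x' i c)) h k))
    (hmem : D.memory ((List.range h).map (markedAlt a b p (e ∘ x))).reverse =
      D.memory ((List.range h).map (markedAlt a b p (e ∘ x'))).reverse) : x = x' := by
  classical
  by_contra hne
  have hmono : StrictMono p := strictMono_nat_of_lt_succ fun k => by have := hp k; omega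
  obtain ⟨i, hi, hmin⟩ : ∃ i, x i ≠ x' i ∧ ∀ l < i, x l = x' l := by
    have hex : ∃ i : ℕ, ∃ hi : i < m, x ⟨i, hi⟩ ≠ x' ⟨i, hi⟩ := by
      obtain ⟨i, hi⟩ := Function.ne_iff.1 hne
      exact ⟨i, i.2, hi⟩
    refine ⟨⟨Nat.find hex, (Nat.find_spec hex).1⟩, (Nat.find_spec hex).2, fun l hl => ?_⟩
    have := Nat.find_min hex (m := l) hl
    push Not at this
    exact this l.2
  have hq : queryAt x' i (x i) = queryAt x i (x i) := by
    funext l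
    unfold queryAt
    split_ifs with hl
    exacts [(hmin l hl).symm, rfl]
  have hlow : (p (i + 1) : ℝ) ≤ maxPalRadius (biWord (markedAlt a b p (e ∘ x))
      (markedAlt a b p (e ∘ queryAt x i (x i))) h k) := by
    have hpm : p (i + 1) ≤ p m := hmono.monotone i.2
    refine Nat.cast_le.2 (le_maxPalRadius_of_marks_eq hmono (fun l hl => ?_)
      (hpm.trans hh) (hpm.trans hk))
    have hl' : l ≤ i := Nat.lt_succ_iff.1 hl
    rcases hl'.lt_or_eq with h1 | rfl
    · simp [queryAt, h1]
    · simp [queryAt]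
  have hup : (maxPalRadius (biWord (markedAlt a b p (e ∘ x'))
      (markedAlt a b p (e ∘ queryAt x i (x i))) h k) : ℝ) ≤ p i := by
    refine Nat.cast_le.2 (maxPalRadius_le_of_mark_ne hab h0 hp ?_ h k)
    simpa [queryAt] using fun hxx => hi (he hxx).symm
  have hans : D.answer (biWord (markedAlt a b p (e ∘ x))
      (markedAlt a b p (e ∘ queryAt x i (x i))) h k) = D.answer (biWord (markedAlt a b p (e ∘ x'))
      (markedAlt a b p (e ∘ queryAt x i (x i))) h k) := by
    have hk0 : 0 < k := lt_of_lt_of_le (by have := hmono.monotone (Nat.zero_le m); omega) hk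
    refine D.answer_append_eq (by simp) hmem ?_
    simpa [List.range_eq_nil] using hk0.ne'
  have h1 := (hx i (x i)).2
  have h2 := (hx' i (x i)).1
  rw [hq] at h2
  rw [hans] at h1
  have h3 := mul_le_mul_of_nonneg_left (h2.trans hup) (by linarith : 0 ≤ 1 + ε)
  linarith [hgrow i]

/-! ### Counting memory states of a randomized algorithm -/

open MeasureTheory in
/-- Random injectivity: if every `x` lies in a random set with probability at least `q` and an encoding
into `Y` is always injective on this set, then `|X| q ≤ |Y|`. -/
theorem card_mul_le_card_of_injOn {Ω X Y : Type*} [MeasurableSpace Ω] (μ : Measure Ω)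
    [IsProbabilityMeasure μ] [Fintype X] [Fintype Y] {G : X → Set Ω}
    (hG : ∀ x, MeasurableSet (G x)) {q : ℝ} (hq : ∀ x, q ≤ μ.real (G x)) (enc : Ω → X → Y)
    (henc : ∀ ω, Set.InjOn (enc ω) {x | ω ∈ G x}) :
    (Fintype.card X : ℝ) * q ≤ Fintype.card Y := by
  classical
  have hint : ∀ x, Integrable ((G x).indicator fun _ => (1 : ℝ)) μ := fun x =>
    (integrable_const 1).indicator (hG x)
  calc (Fintype.card X : ℝ) * q = ∑ _x : X, q := by simp
    _ ≤ ∑ x, μ.real (G x) := Finset.sum_le_sum fun x _ => hq x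
    _ = ∫ ω, ∑ x, (G x).indicator (fun _ => (1 : ℝ)) ω ∂μ := by
      rw [integral_finsetSum _ fun x _ => hint x]
      refine Finset.sum_congr rfl fun x _ => ?_
      rw [integral_indicator_const _ (hG x), smul_eq_mul, mul_one]
    _ ≤ ∫ _ω, (Fintype.card Y : ℝ) ∂μ := by
      refine integral_mono (integrable_finsetSum _ fun x _ => hint x) (integrable_const _)
        fun ω => ?_
      have hcard : (Finset.univ.filter fun x => ω ∈ G x).card ≤ Fintype.card Y :=
        Finset.card_le_card_of_injOn (t := Finset.univ) (enc ω)
          (fun _ _ => Finset.mem_coe.2 (Finset.mem_univ _)) (by simpa using henc ω)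
      simpa [Set.indicator_apply, Finset.sum_boole] using hcard
    _ = Fintype.card Y := by simp

theorem MonteCarloStreamAlg.measurableSet_correct {A : Type*} {s : ℕ} {Ω : Type*}
    [MeasurableSpace Ω] (M : MonteCarloStreamAlg A s Ω) (ε : ℝ) (w : List A) :
    MeasurableSet {ω | (M.alg ω).Correct ε w} :=
  (measurableSet_le (M.measurable_answer w) measurable_const).inter
    (measurableSet_le measurable_const ((M.measurable_answer w).const_mul _))

open MeasureTheory in
/-- If the number of queries to a message is less than half of the inverse error probability, then the
memory has room for more than half of the messages. -/
theorem MonteCarloStreamAlg.card_pow_lt {A : Type*} {s : ℕ} {Ω : Type*} [MeasurableSpace Ω]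
    (M : MonteCarloStreamAlg A s Ω) {n : ℕ} {ε : ℝ} (hε : 0 ≤ ε)
    (hM : M.SolvesMultiplicative n ε (1 - 1 / (n : ℝ))) {a b : A} (hab : a ≠ b) {p : ℕ → ℕ}
    (h0 : 2 ≤ p 0) (hp : ∀ k, p k + 4 ≤ p (k + 1)) (hgrow : ∀ k, (1 + ε) * p k < p (k + 1))
    {m : ℕ} (hpm : p m ≤ n / 2) {B : Type*} [Fintype B] [Nonempty B] {e : B → A}
    (he : Function.Injective e) (hmn : 2 * ((m : ℝ) * Fintype.card B) < n) :
    (Fintype.card B : ℝ) ^ m < 2 ^ (s + 1) := by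
  classical
  have := M.isProb
  set word : (Fin m → B) → Fin m → B → List A := fun x i c =>
    biWord (markedAlt a b p (e ∘ x)) (markedAlt a b p (e ∘ queryAt x i c)) (n / 2) (n - n / 2)
    with hword
  set C : (Fin m → B) → Fin m × B → Set Ω := fun x ic =>
    {ω | (M.alg ω).Correct ε (word x ic.1 ic.2)} with hC
  have hCm : ∀ x ic, MeasurableSet (C x ic) := fun x ic => M.measurableSet_correct ε _
  have hCp : ∀ x ic, M.prob.real (C x ic)ᶜ ≤ 1 / n := fun x ic => by
    have h1 : 1 - 1 / (n : ℝ) ≤ M.prob.real (C x ic) :=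
      hM (word x ic.1 ic.2) (by simp only [hword, length_biWord]; omega)
    rw [probReal_compl_eq_one_sub (hCm x ic)]
    linarith
  have hn0 : (0 : ℝ) < n := lt_of_le_of_lt (by positivity) hmn
  have hG : ∀ x, 1 - (m : ℝ) * Fintype.card B * (1 / n) ≤ M.prob.real (⋂ ic, C x ic) := fun x => by
    have h1 : M.prob.real (⋂ ic, C x ic)ᶜ ≤ (m : ℝ) * Fintype.card B * (1 / n) := by
      rw [Set.compl_iInter]
      refine (measureReal_iUnion_fintype_le _).trans
        ((Finset.sum_le_sum fun ic _ => hCp x ic).trans_eq ?_)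
      simp
    rw [probReal_compl_eq_one_sub (MeasurableSet.iInter (hCm x))] at h1
    linarith
  have hcount := card_mul_le_card_of_injOn (Y := Fin s → Bool) M.prob
    (fun x => MeasurableSet.iInter (hCm x)) hG
    (fun ω x => (M.alg ω).memory ((List.range (n / 2)).map (markedAlt a b p (e ∘ x))).reverse)
    (fun ω x hx x' hx' hmem => (M.alg ω).eq_of_memory_eq hab h0 hp hε hgrow hpm (by omega) he
      (fun i c => Set.mem_iInter.1 hx (i, c)) (fun i c => Set.mem_iInter.1 hx' (i, c)) hmem)
  simp only [Fintype.card_fun, Fintype.card_fin, Fintype.card_bool, Nat.cast_pow,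
    Nat.cast_ofNat] at hcount
  have hhalf : 1 / 2 < 1 - (m : ℝ) * Fintype.card B * (1 / n) := by
    have : (m : ℝ) * Fintype.card B * (1 / n) < 1 / 2 := by
      rw [mul_one_div, div_lt_div_iff₀ hn0 two_pos]
      linarith
    linarith
  have hpos : (0 : ℝ) < (Fintype.card B : ℝ) ^ m := by
    have : 0 < Fintype.card B := Fintype.card_pos
    positivity
  have := mul_lt_mul_of_pos_left hhalf hpos
  rw [pow_succ]
  linarith

/-! ### Positions of the marks -/

/-- Positions that grow by slightly more than the factor `1 + ε`. -/
noncomputable def markPos (ε : ℝ) : ℕ → ℕ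
  | 0 => 2
  | k + 1 => ⌊(1 + ε) * markPos ε k⌋₊ + 4

theorem mul_markPos_lt (ε : ℝ) (k : ℕ) : (1 + ε) * markPos ε k < markPos ε (k + 1) := by
  have := Nat.lt_floor_add_one ((1 + ε) * markPos ε k)
  rw [markPos]
  push_cast
  linarith

theorem markPos_add_four_le {ε : ℝ} (hε : 0 ≤ ε) (k : ℕ) : markPos ε k + 4 ≤ markPos ε (k + 1) := by
  rw [markPos]
  have : markPos ε k ≤ ⌊(1 + ε) * markPos ε k⌋₊ :=
    Nat.le_floor (le_mul_of_one_le_left (Nat.cast_nonneg _) (by linarith))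
  omega

/-- The additive term `4` of the recursion contributes only the factor `2 + 4 / ε`. -/
theorem markPos_le {ε : ℝ} (hε : 0 < ε) (k : ℕ) :
    (markPos ε k : ℝ) ≤ (1 + ε) ^ k * (2 + 4 / ε) := by
  have key : (markPos ε k : ℝ) + 4 / ε ≤ (1 + ε) ^ k * (2 + 4 / ε) := by
    induction k with
    | zero => simp [markPos]
    | succ k ih =>
      have h1 : (markPos ε (k + 1) : ℝ) ≤ (1 + ε) * markPos ε k + 4 := by
        rw [markPos]
        push_cast
        linarith [Nat.floor_le (by positivity : 0 ≤ (1 + ε) * (markPos ε k : ℝ))]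
      have h2 : (1 + ε) * (markPos ε k + 4 / ε) = (1 + ε) * markPos ε k + 4 + 4 / ε := by
        field_simp
        ring
      calc (markPos ε (k + 1) : ℝ) + 4 / ε ≤ (1 + ε) * (markPos ε k + 4 / ε) := by linarith
        _ ≤ (1 + ε) * ((1 + ε) ^ k * (2 + 4 / ε)) := by gcongr
        _ = _ := by ring
  have : 0 < 4 / ε := by positivity
  linarith

/-! ### Numerical estimates -/

section Asymptotics

variable {n : ℕ} {ε : ℝ}

theorem one_div_le_rpow (hn : 0 < n) (h1 : (n : ℝ) ^ (-0.98 : ℝ) ≤ ε) :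
    1 / ε ≤ (n : ℝ) ^ (0.98 : ℝ) := by
  have hn0 : (0 : ℝ) < n := by exact_mod_cast hn
  rw [one_div, ← inv_inv ((n : ℝ) ^ (0.98 : ℝ)), ← Real.rpow_neg hn0.le]
  exact inv_anti₀ (Real.rpow_pos_of_pos hn0 _) h1

/-- The bound is far below `n`, so that a power of `n` remains for the number of letters in the union
bound. -/
theorem log_div_log_le (hn : 1 ≤ n) (h1 : (n : ℝ) ^ (-0.98 : ℝ) ≤ ε) :
    Real.log n / Real.log (1 + ε) ≤ 200 * (n : ℝ) ^ (0.99 : ℝ) := by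
  have hn1 : (1 : ℝ) ≤ n := by exact_mod_cast hn
  have hn0 : (0 : ℝ) < n := by linarith
  have hε : 0 < ε := (Real.rpow_pos_of_pos hn0 _).trans_le h1
  have hlog : (1 + 1 / ε)⁻¹ ≤ Real.log (1 + ε) := by
    refine le_trans (le_of_eq ?_) (Real.one_sub_inv_le_log_of_pos (by linarith : 0 < 1 + ε))
    field_simp
    ring
  have hinv := one_div_le_rpow (by omega) h1
  have h98 : 1 ≤ (n : ℝ) ^ (0.98 : ℝ) := Real.one_le_rpow hn1 (by norm_num)
  have hL : Real.log n ≤ 100 * (n : ℝ) ^ (0.01 : ℝ) := by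
    have := Real.log_le_rpow_div hn0.le (by norm_num : (0 : ℝ) < 0.01)
    rwa [show (n : ℝ) ^ (0.01 : ℝ) / 0.01 = 100 * (n : ℝ) ^ (0.01 : ℝ) by ring] at this
  have hL0 : 0 ≤ Real.log n := Real.log_nonneg hn1
  calc Real.log n / Real.log (1 + ε) ≤ Real.log n / (1 + 1 / ε)⁻¹ := by
        gcongr
    _ = Real.log n * (1 + 1 / ε) := by rw [div_inv_eq_mul]
    _ ≤ (100 * (n : ℝ) ^ (0.01 : ℝ)) * (2 * (n : ℝ) ^ (0.98 : ℝ)) := by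
        gcongr
        linarith
    _ = 200 * (n : ℝ) ^ (0.99 : ℝ) := by
        rw [show (0.99 : ℝ) = 0.01 + 0.98 by norm_num, Real.rpow_add hn0]
        ring

/-- All marks fit into half of a word of length `n`. -/
theorem markPos_le_half (hn : 3 ≤ n) (hbig : 200 ≤ (n : ℝ) ^ (0.01 : ℝ))
    (h1 : (n : ℝ) ^ (-0.98 : ℝ) ≤ ε) (h2 : ε ≤ (n : ℝ) ^ (0.49 : ℝ)) :
    markPos ε ⌈0.01 * (Real.log n / Real.log (1 + ε))⌉₊ ≤ n / 2 := by
  have hn1 : (1 : ℝ) ≤ n := by exact_mod_cast (by omega : 1 ≤ n)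
  have hn0 : (0 : ℝ) < n := by linarith
  have hε : 0 < ε := (Real.rpow_pos_of_pos hn0 _).trans_le h1
  have ht : 0 < Real.log (1 + ε) := Real.log_pos (by linarith)
  have hL0 : 0 ≤ Real.log n := Real.log_nonneg hn1
  have hinv := one_div_le_rpow (by omega) h1
  set m := ⌈0.01 * (Real.log n / Real.log (1 + ε))⌉₊ with hm
  have hm1 : (m : ℝ) ≤ 0.01 * (Real.log n / Real.log (1 + ε)) + 1 :=
    (Nat.ceil_lt_add_one (by positivity)).le
  have hpow : (1 + ε) ^ m ≤ (n : ℝ) ^ (0.01 : ℝ) * (1 + ε) := by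
    rw [← Real.log_le_log_iff (by positivity) (by positivity), Real.log_pow,
      Real.log_mul (by positivity) (by positivity), Real.log_rpow hn0]
    calc (m : ℝ) * Real.log (1 + ε)
        ≤ (0.01 * (Real.log n / Real.log (1 + ε)) + 1) * Real.log (1 + ε) := by gcongr
      _ = 0.01 * Real.log n + Real.log (1 + ε) := by field_simp
  have h98 : 1 ≤ (n : ℝ) ^ (0.98 : ℝ) := Real.one_le_rpow hn1 (by norm_num)
  have h49 : (n : ℝ) ^ (0.49 : ℝ) ≤ (n : ℝ) ^ (0.98 : ℝ) :=
    Real.rpow_le_rpow_of_exponent_le hn1 (by norm_num)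
  have hprod : (1 + ε) * (2 + 4 / ε) = 6 + 2 * ε + 4 * (1 / ε) := by
    field_simp
    ring
  have hreal : (markPos ε m : ℝ) ≤ n / 3 := by
    calc (markPos ε m : ℝ) ≤ (1 + ε) ^ m * (2 + 4 / ε) := markPos_le hε m
      _ ≤ (n : ℝ) ^ (0.01 : ℝ) * (1 + ε) * (2 + 4 / ε) := by gcongr
      _ = (n : ℝ) ^ (0.01 : ℝ) * (6 + 2 * ε + 4 * (1 / ε)) := by rw [mul_assoc, hprod]
      _ ≤ (n : ℝ) ^ (0.01 : ℝ) * (12 * (n : ℝ) ^ (0.98 : ℝ)) := by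
        gcongr
        linarith
      _ = 12 * (n : ℝ) ^ (0.99 : ℝ) := by
        rw [show (0.99 : ℝ) = 0.01 + 0.98 by norm_num, Real.rpow_add hn0]
        ring
      _ ≤ (n : ℝ) ^ (0.01 : ℝ) * (n : ℝ) ^ (0.99 : ℝ) / 3 := by
        have : 0 < (n : ℝ) ^ (0.99 : ℝ) := by positivity
        nlinarith
      _ = n / 3 := by
        rw [← Real.rpow_add hn0]
        norm_num
  have : 3 * markPos ε m ≤ n := by
    have : (3 : ℝ) * markPos ε m ≤ n := by linarith
    exact_mod_cast this
  omega

/-- The number of queries is less than `n / 2`. -/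
theorem two_mul_queries_lt (hn : 1 ≤ n) (hbig : 200 ≤ (n : ℝ) ^ (0.009 : ℝ))
    (h1 : (n : ℝ) ^ (-0.98 : ℝ) ≤ ε) :
    2 * ((⌈0.01 * (Real.log n / Real.log (1 + ε))⌉₊ : ℝ) * ⌈(n : ℝ) ^ (0.001 : ℝ)⌉₊) < n := by
  have hn1 : (1 : ℝ) ≤ n := by exact_mod_cast hn
  have hn0 : (0 : ℝ) < n := by linarith
  have hε : 0 < ε := (Real.rpow_pos_of_pos hn0 _).trans_le h1
  have ht : 0 < Real.log (1 + ε) := Real.log_pos (by linarith)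
  have hL0 : 0 ≤ Real.log n := Real.log_nonneg hn1
  have h99 : 1 ≤ (n : ℝ) ^ (0.99 : ℝ) := Real.one_le_rpow hn1 (by norm_num)
  have h001 : 1 ≤ (n : ℝ) ^ (0.001 : ℝ) := Real.one_le_rpow hn1 (by norm_num)
  have hm : (⌈0.01 * (Real.log n / Real.log (1 + ε))⌉₊ : ℝ) ≤ 3 * (n : ℝ) ^ (0.99 : ℝ) := by
    have := Nat.ceil_lt_add_one (by positivity : 0 ≤ 0.01 * (Real.log n / Real.log (1 + ε)))
    linarith [log_div_log_le hn h1]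
  have hσ : (⌈(n : ℝ) ^ (0.001 : ℝ)⌉₊ : ℝ) ≤ 2 * (n : ℝ) ^ (0.001 : ℝ) := by
    have := Nat.ceil_lt_add_one (by positivity : 0 ≤ (n : ℝ) ^ (0.001 : ℝ))
    linarith
  calc _ ≤ 2 * ((3 * (n : ℝ) ^ (0.99 : ℝ)) * (2 * (n : ℝ) ^ (0.001 : ℝ))) := by gcongr
    _ = 12 * ((n : ℝ) ^ (0.99 : ℝ) * (n : ℝ) ^ (0.001 : ℝ)) := by ring
    _ < (n : ℝ) ^ (0.009 : ℝ) * ((n : ℝ) ^ (0.99 : ℝ) * (n : ℝ) ^ (0.001 : ℝ)) := by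
      gcongr
      linarith
    _ = n := by
      rw [← Real.rpow_add hn0, ← Real.rpow_add hn0]
      norm_num

/-- Capping the alphabet at `n ^ 0.001` letters costs only a constant factor in its logarithm. -/
theorem log_min_le (hn : 1 ≤ n) {q : ℕ} (hq : 2 ≤ q) {r : ℝ} (hr0 : 0 < r) (hr : r ≤ n) :
    Real.log (min (q : ℝ) r) ≤
      1000 * Real.log ((min q ⌈(n : ℝ) ^ (0.001 : ℝ)⌉₊ : ℕ) : ℝ) := by
  have hn0 : (0 : ℝ) < n := by exact_mod_cast hn
  have hq0 : (0 : ℝ) < q := by exact_mod_cast (by omega : 0 < q)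
  rcases min_choice q ⌈(n : ℝ) ^ (0.001 : ℝ)⌉₊ with h | h <;> rw [h]
  · have h1 : Real.log (min (q : ℝ) r) ≤ Real.log q :=
      Real.log_le_log (lt_min hq0 hr0) (min_le_left _ _)
    have h2 : 0 ≤ Real.log (q : ℝ) := Real.log_natCast_nonneg q
    linarith
  · have h1 : Real.log (min (q : ℝ) r) ≤ Real.log n :=
      Real.log_le_log (lt_min hq0 hr0) ((min_le_right _ _).trans hr)
    have h2 := Real.log_le_log (by positivity) (Nat.le_ceil ((n : ℝ) ^ (0.001 : ℝ)))
    rw [Real.log_rpow hn0] at h2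
    linarith

end Asymptotics

/-! ### The lower bound -/

theorem mainTheorem2 :
    ∃ c : ℝ, 0 < c ∧ ∃ N : ℕ, ∀ n : ℕ, N ≤ n → ∀ ε : ℝ,
      (n : ℝ) ^ (-0.98 : ℝ) ≤ ε → ε ≤ (n : ℝ) ^ (0.49 : ℝ) →
      ∀ (A : Type*) [Fintype A] [Nonempty A] (s : ℕ) (Ω : Type*) [MeasurableSpace Ω]
        (M : MonteCarloStreamAlg A s Ω),
        M.SolvesMultiplicative n ε (1 - 1 / (n : ℝ)) →
        c * (Real.log n / Real.log (1 + ε) *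
          Real.log (min (Fintype.card A : ℝ) (Real.log n / Real.log (1 + ε)))) ≤ (s : ℝ) := by
  -- A large power `n ^ 0.009` absorbs all constants below; the exponent is what is left of `1` after
  -- `0.99` for the number of marks and `0.001` for the number of letters.
  obtain ⟨N, hN⟩ := Filter.eventually_atTop.1 (((tendsto_rpow_atTop
    (by norm_num : (0 : ℝ) < 0.009)).comp tendsto_natCast_atTop_atTop).eventually_ge_atTop 200)
  refine ⟨1 / 10 ^ 6, by positivity, max N 3, fun n hn ε h1 h2 A _ _ s Ω _ M hM => ?_⟩
  have hn3 : 3 ≤ n := (le_max_right N 3).trans hn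
  have hbig : 200 ≤ (n : ℝ) ^ (0.009 : ℝ) := hN n ((le_max_left N 3).trans hn)
  have hn1 : (1 : ℝ) < n := by exact_mod_cast (by omega : 1 < n)
  have hn0 : (0 : ℝ) < n := by linarith
  have hbig' : 200 ≤ (n : ℝ) ^ (0.01 : ℝ) :=
    hbig.trans (Real.rpow_le_rpow_of_exponent_le hn1.le (by norm_num))
  have hε : 0 < ε := (Real.rpow_pos_of_pos hn0 _).trans_le h1
  have hratio : 0 < Real.log n / Real.log (1 + ε) :=
    div_pos (Real.log_pos hn1) (Real.log_pos (by linarith))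
  have hratio_le : Real.log n / Real.log (1 + ε) ≤ n := by
    refine (log_div_log_le (by omega) h1).trans ?_
    calc 200 * (n : ℝ) ^ (0.99 : ℝ) ≤ (n : ℝ) ^ (0.01 : ℝ) * (n : ℝ) ^ (0.99 : ℝ) := by gcongr
      _ = n := by
        rw [← Real.rpow_add hn0]
        norm_num
  have hpm := markPos_le_half hn3 hbig' h1 h2
  have hqueries := two_mul_queries_lt (by omega) hbig h1
  set ratio := Real.log n / Real.log (1 + ε) with hratio_def
  set m := ⌈0.01 * ratio⌉₊ with hm
  rcases le_or_gt (Fintype.card A) 1 with hA | hA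
  · -- Over a unary alphabet the bound is not positive.
    have hlog : Real.log (min (Fintype.card A : ℝ) ratio) ≤ 0 :=
      Real.log_nonpos (le_min (Nat.cast_nonneg _) hratio.le)
        ((min_le_left _ _).trans (by exact_mod_cast hA))
    have := mul_nonpos_of_nonneg_of_nonpos hratio.le hlog
    have hs : (0 : ℝ) ≤ s := Nat.cast_nonneg s
    linarith
  have hlogmin := log_min_le (by omega : 1 ≤ n) hA hratio hratio_le
  have htwo : 2 ≤ ⌈(n : ℝ) ^ (0.001 : ℝ)⌉₊ :=
    Nat.lt_ceil.2 (by simpa using Real.one_lt_rpow hn1 (by norm_num : (0 : ℝ) < 0.001))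
  set q := min (Fintype.card A) ⌈(n : ℝ) ^ (0.001 : ℝ)⌉₊ with hq
  have hq2 : 2 ≤ q := le_min hA htwo
  have : NeZero q := ⟨by omega⟩
  obtain ⟨a, b, hab⟩ := Fintype.one_lt_card_iff.1 hA
  obtain ⟨e⟩ : Nonempty (Fin q ↪ A) :=
    Function.Embedding.nonempty_of_card_le (by simp [hq])
  have hmq : 2 * ((m : ℝ) * Fintype.card (Fin q)) < n := by
    refine lt_of_le_of_lt ?_ hqueries
    rw [Fintype.card_fin]
    gcongr
    exact min_le_right _ _
  have hpow := M.card_pow_lt hε.le hM hab le_rfl (markPos_add_four_le hε.le) (mul_markPos_lt ε) hpm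
    e.injective hmq
  rw [Fintype.card_fin] at hpow
  have hm0 : m ≠ 0 := (Nat.ceil_pos.2 (by positivity)).ne'
  -- Since `2 ≤ q ^ m`, the memory is not empty, and the additive loss of one bit is harmless.
  have hs1 : (1 : ℝ) ≤ s := by
    have h3 : 2 ^ 1 < 2 ^ (s + 1) := by
      have : q ^ m < 2 ^ (s + 1) := by exact_mod_cast hpow
      rw [pow_one]
      exact (hq2.trans (Nat.le_self_pow hm0 q)).trans_lt this
    have := (Nat.pow_lt_pow_iff_right (by norm_num)).1 h3
    exact_mod_cast (by omega : 1 ≤ s)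
  have hq0 : (0 : ℝ) < q := by exact_mod_cast (by omega : 0 < q)
  have hlog := Real.log_lt_log (pow_pos hq0 m) hpow
  rw [Real.log_pow, Real.log_pow] at hlog
  push_cast at hlog
  have hlogq : 0 ≤ Real.log (q : ℝ) := Real.log_natCast_nonneg q
  have hlow : 0.01 * ratio * Real.log q ≤ m * Real.log q := by
    gcongr
    exact Nat.le_ceil _
  have hlog2 : (s + 1 : ℝ) * Real.log 2 ≤ 2 * s := by
    have := Real.log_two_lt_d9
    nlinarith
  have hmul := mul_le_mul_of_nonneg_left hlogmin hratio.le
  linarith
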